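/- Let $m,n\ge 0$ be integers and let $x_1,\dots,x_{m+n}$ be commuting variables. The index $i$ is called even ($\hat i=0$) if $1\le i\le m$ and odd ($\hat i=1$) if $m<i\le m+n$. For a partition $\lambda$, with transposed partition $\lambda'$, let $$hs_\lambda(x_1,\dots,x_{m+n})=\sum_{\mu\subseteq\lambda}s_\mu(x_1,\dots,x_m)\,s_{\lambda'/\mu'}(x_{m+1},\dots,x_{m+n})$$ be the hook Schur function of $m$ even and $n$ odd variables. Here the sum runs over all partitions $\mu$ whose Young diagram is contained in that of $\lambda$, and $s_{\lambda/\mu}(y_1,\dots,y_k)$ (with $s_\mu=s_{\mu/\emptyset}$) is the skew Schur polynomial, i.e. the sum of the monomials $\prod_c y_{T(c)}$ over all fillings $T$ of the cells $c$ of $\lambda/\mu$ with entries in $\{1,\dots,k\}$ that are nondecreasing along rows and strictly increasing down columns. Then, in the ring of formal power series $\mathbb Z[[x_1,\dots,x_{m+n}]]$, the denominator below is invertible, the sum on the right over all partitions $\lambda$ converges coefficientwise (for each monomial only finitely many $\lambda$ contribute), and $$\frac{\displaystyle\prod_{i<j,\ \hat i\ne\hat j}(1+x_ix_j)}{\displaystyle\prod_{i}(1-x_i)\prod_{i<j,\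 \hat i=\hat j}(1-x_ix_j)}=\sum_{\lambda}hs_\lambda(x_1,\dots,x_{m+n}),$$ where $i,j$ range over $\{1,\dots,m+n\}$. -/

import Mathlib

open scoped MvPowerSeries.WithPiTopology

namespace HookSchur

/-- A filling of the cells of the skew shape `lam / mu` by the letters `0 < 1 < ⋯ < k - 1` is
semistandard if it is nondecreasing along the rows and increasing down the columns.
A cell is a pair (row, column). -/
def IsSemistandard {k : ℕ} (lam mu : YoungDiagram)
    (T : {c : ℕ × ℕ // c ∈ lam.cells \ mu.cells} → Fin k) : Prop :=
  (∀ c d, c.1.1 = d.1.1 → c.1.2 < d.1.2 → T c ≤ T d) ∧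
    (∀ c d, c.1.2 = d.1.2 → c.1.1 < d.1.1 → T c < T d)

open Classical in
/-- The skew Schur polynomial `s_{lam/mu}` in `k` variables (used for `mu ⊆ lam` only): the sum
of the weights of all semistandard fillings of `lam / mu`. -/
noncomputable def skewSchur (k : ℕ) (lam mu : YoungDiagram) : MvPolynomial (Fin k) ℤ :=
  ∑ T : {T : {c : ℕ × ℕ // c ∈ lam.cells \ mu.cells} → Fin k // IsSemistandard lam mu T},
    ∏ c, MvPolynomial.X (T.1 c)

/-- The Schur polynomial `s_mu` in `k` variables. -/
noncomputable def schur (k : ℕ) (mu : YoungDiagram) : MvPolynomial (Fin k) ℤ :=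
  skewSchur k mu ⊥

/-- A Young diagram contains only finitely many Young diagrams. -/
theorem finite_subdiagrams (lam : YoungDiagram) : {mu : YoungDiagram | mu ≤ lam}.Finite := by
  refine Set.Finite.of_injOn (f := YoungDiagram.cells) (t := (lam.cells.powerset : Set _))
    ?_ ?_ (Finset.finite_toSet _)
  · intro mu hmu
    simpa using hmu
  · intro a _ b _ h
    exact YoungDiagram.ext h

/-- The hook Schur function of `m` even and `n` odd variables,
`hs_lam (x_1, …, x_{m+n}) =
  ∑_{mu ⊆ lam} s_mu (x_1, …, x_m) * s_{lam'/mu'} (x_{m+1}, …, x_{m+n})`,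
where the prime denotes the transposed diagram. -/
noncomputable def hookSchur (m n : ℕ) (lam : YoungDiagram) : MvPolynomial (Fin (m + n)) ℤ :=
  ∑ mu ∈ (finite_subdiagrams lam).toFinset,
    MvPolynomial.rename (Fin.castAdd n) (schur m mu) *
      MvPolynomial.rename (Fin.natAdd m) (skewSchur n lam.transpose mu.transpose)

/-- The parity of an index: the first `m` indices are even, the last `n` are odd. -/
def parity (m n : ℕ) (i : Fin (m + n)) : ZMod 2 :=
  if (i : ℕ) < m then 0 else 1

/-- The numerator `∏_{i<j, parity i ≠ parity j} (1 + x_i x_j)`. -/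
noncomputable def numerator (m n : ℕ) : MvPowerSeries (Fin (m + n)) ℤ :=
  ∏ p : Fin (m + n) × Fin (m + n) with p.1 < p.2 ∧ parity m n p.1 ≠ parity m n p.2,
    (1 + MvPowerSeries.X p.1 * MvPowerSeries.X p.2)

/-- The denominator `∏_i (1 - x_i) * ∏_{i<j, parity i = parity j} (1 - x_i x_j)`. -/
noncomputable def denominator (m n : ℕ) : MvPowerSeries (Fin (m + n)) ℤ :=
  (∏ i : Fin (m + n), (1 - MvPowerSeries.X i)) *
    ∏ p : Fin (m + n) × Fin (m + n) with p.1 < p.2 ∧ parity m n p.1 = parity m n p.2,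
      (1 - MvPowerSeries.X p.1 * MvPowerSeries.X p.2)

end HookSchur

/-!
The sum of all hook Schur functions is computed by adding the variables one at a time.

By the branching rule (`skewSchurEval_succ`), adding a largest letter `t` to semistandard fillings
applies the raising operator of the matrix `hStrip t` of horizontal strips, so the family of all
`s_lam (x_1, …, x_m)` arises from the unit vector of the empty diagram by `m` raising operators.
Transposing, an odd variable applies the operator of the matrix `vStrip t` of vertical strips, and
the family of all `hs_lam` arises by `n` further raising operators (`coe_hookSchur`).

Three facts about these operators and their transposes, the lowering operators, are needed.

* Cauchy's identity (`mul_tsum_hStrip_mul_hStrip`): lowering by `b` after raising by `a` is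
  `1 / (1 - a b)` times raising by `a` after lowering by `b`. It rests on the bijection
  `toggleEquiv`, which reflects every row in the interval in which it may vary. Transposition gives
  the same for vertical strips.
* The same identity for equal diagrams and `b = 1` says that the sum of all coordinates of a vector
  raised by `t` is `1 / (1 - t)` times that of the vector lowered by `t` (`mul_tsum_hStrip`).
* Lowering along vertical strips with `t` is inverse to lowering along horizontal strips with `-t`
  (`tsum_hStrip_neg_mul_vStrip`, by the sign-reversing involution of `sum_strips_eq_zero`).
  Together with Cauchy's identity for `-t`, this gives the factors `1 + x_i t` of the dual Cauchy
  identity (`down_vStrip_iterUp_hStrip`).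

Hence, if a vector is an eigenvector of the lowering operators, so is every vector raised from it
(`prod_mul_down_iterUp`), and each new variable `t` multiplies the sum of all coordinates by
`1 / (1 - t)` and by the eigenvalue (`pairProduct_mul_tsum_iterUp`). This produces the factors of
the product one variable at a time. All sums are exchanged in the ring of power series, where
summability follows from lower bounds for the orders (`IsGraded`, `IsGradedMatrix`).
-/

namespace HookSchur

/-! ### Young diagrams as row-length sequences -/

/-- The Young diagram with row lengths `f 0 ≥ f 1 ≥ ⋯`, for an antitone sequence that vanishes
from index `N` on. -/
def ofRowLen (f : ℕ → ℕ) (N : ℕ) (hf : Antitone f) (_hN : f N = 0) : YoungDiagram where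
  cells := (Finset.range N ×ˢ Finset.range (f 0)).filter fun c => c.2 < f c.1
  isLowerSet := by
    rintro ⟨i, j⟩ ⟨i', j'⟩ ⟨hi, hj⟩ h
    simp only [Finset.coe_filter, Finset.mem_product, Finset.mem_range, Set.mem_ofPred_eq] at h ⊢
    have hi' : i' ≤ i := hi
    have hj' : j' ≤ j := hj
    have h1 : f i ≤ f i' := hf hi'
    have h2 : f i' ≤ f 0 := hf (Nat.zero_le i')
    omega

theorem rowLen_ofRowLen (f : ℕ → ℕ) (N : ℕ) (hf : Antitone f) (hN : f N = 0) (i : ℕ) :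
    (ofRowLen f N hf hN).rowLen i = f i := by
  have key : ∀ j, j < (ofRowLen f N hf hN).rowLen i ↔ j < f i := by
    intro j
    rw [← YoungDiagram.mem_iff_lt_rowLen, ← YoungDiagram.mem_cells]
    simp only [ofRowLen, Finset.mem_filter, Finset.mem_product, Finset.mem_range,
      and_iff_right_iff_imp]
    intro h
    have h0 := hf (Nat.zero_le i)
    refine ⟨?_, by omega⟩
    by_contra hi
    have := hf (not_lt.mp hi)
    omega
  have h1 := key (f i)
  have h2 := key ((ofRowLen f N hf hN).rowLen i)
  omega

theorem ext_rowLen {lam mu : YoungDiagram} (h : ∀ i, lam.rowLen i = mu.rowLen i) : lam = mu := by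
  ext ⟨i, j⟩
  rw [YoungDiagram.mem_cells, YoungDiagram.mem_cells, YoungDiagram.mem_iff_lt_rowLen,
    YoungDiagram.mem_iff_lt_rowLen, h]

theorem rowLen_eq_zero_of_colLen_le {lam : YoungDiagram} {i : ℕ} (h : lam.colLen 0 ≤ i) :
    lam.rowLen i = 0 := by
  by_contra h0
  have : (i, 0) ∈ lam := YoungDiagram.mem_iff_lt_rowLen.2 (Nat.pos_of_ne_zero h0)
  have := YoungDiagram.mem_iff_lt_colLen.1 this
  omega

theorem card_eq_sum_rowLen (lam : YoungDiagram) {N : ℕ} (hN : lam.rowLen N = 0) :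
    lam.card = ∑ i ∈ Finset.range N, lam.rowLen i := by
  have : lam.cells = (Finset.range N).biUnion lam.row := by
    ext ⟨i, j⟩
    simp only [Finset.mem_biUnion, Finset.mem_range, YoungDiagram.mem_row_iff,
      YoungDiagram.mem_cells]
    refine ⟨fun h => ⟨i, ?_, h, rfl⟩, fun ⟨_, _, h, _⟩ => h⟩
    by_contra hi
    have h1 := lam.rowLen_anti _ _ (not_lt.mp hi)
    have h2 := YoungDiagram.mem_iff_lt_rowLen.1 h
    omega
  rw [YoungDiagram.card, this, Finset.card_biUnion]
  · exact Finset.sum_congr rfl fun i _ => (lam.rowLen_eq_card).symm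
  · intro i _ j _ hij
    rw [Function.onFun, Finset.disjoint_left]
    rintro c h1 h2
    exact hij ((YoungDiagram.mem_row_iff.1 h1).2.symm.trans (YoungDiagram.mem_row_iff.1 h2).2)

theorem le_iff_rowLen {lam mu : YoungDiagram} : mu ≤ lam ↔ ∀ i, mu.rowLen i ≤ lam.rowLen i := by
  constructor
  · intro h i
    by_contra hi
    have h1 : (i, lam.rowLen i) ∈ mu := YoungDiagram.mem_iff_lt_rowLen.2 (by omega)
    have h2 := YoungDiagram.mem_iff_lt_rowLen.1 (h h1)
    omega
  · rintro h ⟨i, j⟩ hc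
    have h1 := YoungDiagram.mem_iff_lt_rowLen.1 hc
    exact YoungDiagram.mem_iff_lt_rowLen.2 (h1.trans_le (h i))

theorem card_le_card {lam mu : YoungDiagram} (h : mu ≤ lam) : mu.card ≤ lam.card :=
  Finset.card_le_card (YoungDiagram.cells_subset_iff.2 h)

theorem card_transpose (lam : YoungDiagram) : lam.transpose.card = lam.card := by
  refine Finset.card_bij' (fun c _ => c.swap) (fun c _ => c.swap) ?_ ?_ ?_ ?_ <;> simp

/-- There are finitely many Young diagrams with at most `d` cells. -/
theorem finite_card_le (d : ℕ) : {lam : YoungDiagram | lam.card ≤ d}.Finite := by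
  refine Set.Finite.of_injOn (f := YoungDiagram.cells)
    (t := ((Finset.range d ×ˢ Finset.range d).powerset : Set (Finset (ℕ × ℕ)))) ?_ ?_
    (Finset.finite_toSet _)
  · intro lam hlam
    simp only [Set.mem_ofPred_eq] at hlam
    simp only [Finset.coe_powerset, Set.mem_preimage, Set.mem_powerset_iff, Finset.coe_subset]
    rintro ⟨i, j⟩ hc
    rw [YoungDiagram.mem_cells] at hc
    -- the first row has more than `j` cells and the first column more than `i`
    have h1 : lam.rowLen 0 ≤ lam.card := by
      rw [lam.rowLen_eq_card]
      exact Finset.card_le_card (Finset.filter_subset _ _)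
    have h2 : lam.colLen 0 ≤ lam.card := by
      rw [lam.colLen_eq_card]
      exact Finset.card_le_card (Finset.filter_subset _ _)
    have h3 := YoungDiagram.mem_iff_lt_rowLen.1 hc
    have h4 := YoungDiagram.mem_iff_lt_colLen.1 hc
    have h5 := lam.rowLen_anti 0 i (Nat.zero_le _)
    have h6 := lam.colLen_anti 0 j (Nat.zero_le _)
    simp only [Finset.mem_product, Finset.mem_range]
    omega
  · intro a _ b _ h
    exact YoungDiagram.ext h

/-! ### Horizontal and vertical strips -/

/-- `lam / mu` is a horizontal strip: `mu ⊆ lam`, and no two cells of `lam` outside `mu` lie in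
the same column. -/
def IsHorizontalStrip (lam mu : YoungDiagram) : Prop :=
  mu ≤ lam ∧ ∀ i j, (i + 1, j) ∈ lam → (i, j) ∈ mu

theorem isHorizontalStrip_iff_rowLen {lam mu : YoungDiagram} :
    IsHorizontalStrip lam mu ↔
      ∀ i, mu.rowLen i ≤ lam.rowLen i ∧ lam.rowLen (i + 1) ≤ mu.rowLen i := by
  rw [IsHorizontalStrip, le_iff_rowLen, forall_and]
  refine and_congr_right fun _ => forall_congr' fun i => ?_
  simp only [YoungDiagram.mem_iff_lt_rowLen]
  refine ⟨fun h => ?_, fun h j hj => by omega⟩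
  by_contra hi
  have := h (mu.rowLen i) (by omega)
  omega

/-- The transposed pair is a horizontal strip exactly when `lam / mu` is a vertical strip, that
is, has at most one cell in every row. -/
theorem isHorizontalStrip_transpose_iff_rowLen {lam mu : YoungDiagram} :
    IsHorizontalStrip lam.transpose mu.transpose ↔
      ∀ i, mu.rowLen i ≤ lam.rowLen i ∧ lam.rowLen i ≤ mu.rowLen i + 1 := by
  rw [IsHorizontalStrip, YoungDiagram.transpose_le_iff, le_iff_rowLen, forall_and, forall_comm]
  refine and_congr_right fun _ => forall_congr' fun i => ?_
  simp only [YoungDiagram.mem_transpose, Prod.swap_prod_mk]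
  simp only [YoungDiagram.mem_iff_lt_rowLen]
  refine ⟨fun h => ?_, fun h j hj => by omega⟩
  by_contra hi
  have := h (mu.rowLen i) (by omega)
  omega

/-- The row lengths of the diagram above `mu` and `nu` that is toggled from a diagram `kap` below
both and the excess `k` of its top row. -/
def toggleRow (mu nu kap : YoungDiagram) (k : ℕ) : ℕ → ℕ
  | 0 => max (mu.rowLen 0) (nu.rowLen 0) + k
  | i + 1 => min (mu.rowLen i) (nu.rowLen i) + max (mu.rowLen (i + 1)) (nu.rowLen (i + 1)) -
      kap.rowLen i

/-- The toggle behind Cauchy's identity. For horizontal strips, row `i + 1` of a diagram above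
`mu` and `nu` and row `i` of a diagram below both range over the same interval
`[max (mu (i+1)) (nu (i+1)), min (mu i) (nu i)]`, which is reflected; the top row of the larger
diagram is unbounded and becomes the natural number. -/
def toggleEquiv (mu nu : YoungDiagram) :
    {lam : YoungDiagram // IsHorizontalStrip lam nu ∧ IsHorizontalStrip lam mu} ≃
      {kap : YoungDiagram // IsHorizontalStrip nu kap ∧ IsHorizontalStrip mu kap} × ℕ where
  toFun lam :=
    have hlam : ∀ i, (nu.rowLen i ≤ lam.1.rowLen i ∧ lam.1.rowLen (i + 1) ≤ nu.rowLen i) ∧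
        mu.rowLen i ≤ lam.1.rowLen i ∧ lam.1.rowLen (i + 1) ≤ mu.rowLen i := fun i =>
      ⟨isHorizontalStrip_iff_rowLen.1 lam.2.1 i, isHorizontalStrip_iff_rowLen.1 lam.2.2 i⟩
    (⟨ofRowLen (fun i => min (mu.rowLen i) (nu.rowLen i) +
          max (mu.rowLen (i + 1)) (nu.rowLen (i + 1)) - lam.1.rowLen (i + 1))
        (mu.colLen 0 + nu.colLen 0)
        (antitone_nat_of_succ_le fun i => by
          have := hlam i; have := hlam (i + 1); have := hlam (i + 1 + 1)
          omega)
        (by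
          have h1 : mu.rowLen (mu.colLen 0 + nu.colLen 0) = 0 :=
            rowLen_eq_zero_of_colLen_le (by omega)
          have h2 := mu.rowLen_anti _ _ (Nat.le_succ (mu.colLen 0 + nu.colLen 0))
          have h3 : nu.rowLen (mu.colLen 0 + nu.colLen 0) = 0 :=
            rowLen_eq_zero_of_colLen_le (by omega)
          have h4 := nu.rowLen_anti _ _ (Nat.le_succ (mu.colLen 0 + nu.colLen 0))
          simp only [Nat.succ_eq_add_one] at h2 h4
          omega), by
        constructor <;>
        · rw [isHorizontalStrip_iff_rowLen]
          intro i
          rw [rowLen_ofRowLen]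
          have := hlam i; have := hlam (i + 1)
          omega⟩,
      lam.1.rowLen 0 - max (mu.rowLen 0) (nu.rowLen 0))
  invFun p :=
    have hkap : ∀ i, (p.1.1.rowLen i ≤ nu.rowLen i ∧ nu.rowLen (i + 1) ≤ p.1.1.rowLen i) ∧
        p.1.1.rowLen i ≤ mu.rowLen i ∧ mu.rowLen (i + 1) ≤ p.1.1.rowLen i := fun i =>
      ⟨isHorizontalStrip_iff_rowLen.1 p.1.2.1 i, isHorizontalStrip_iff_rowLen.1 p.1.2.2 i⟩
    ⟨ofRowLen (toggleRow mu nu p.1.1 p.2)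
        (mu.colLen 0 + nu.colLen 0 + 1)
        (antitone_nat_of_succ_le fun i => by
          cases i with
          | zero =>
            have := hkap 0
            simp only [toggleRow]
            omega
          | succ i =>
            have := hkap i; have := hkap (i + 1)
            simp only [toggleRow]
            omega)
        (by
          have h1 : mu.rowLen (mu.colLen 0 + nu.colLen 0) = 0 :=
            rowLen_eq_zero_of_colLen_le (by omega)
          have h2 := mu.rowLen_anti _ _ (Nat.le_succ (mu.colLen 0 + nu.colLen 0))
          have h3 : nu.rowLen (mu.colLen 0 + nu.colLen 0) = 0 :=
            rowLen_eq_zero_of_colLen_le (by omega)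
          have h4 := nu.rowLen_anti _ _ (Nat.le_succ (mu.colLen 0 + nu.colLen 0))
          simp only [Nat.succ_eq_add_one] at h2 h4
          simp only [toggleRow]
          omega), by
        constructor <;>
        · rw [isHorizontalStrip_iff_rowLen]
          intro i
          rw [rowLen_ofRowLen, rowLen_ofRowLen]
          cases i with
          | zero =>
            have := hkap 0
            simp only [toggleRow]
            omega
          | succ i =>
            have := hkap i; have := hkap (i + 1)
            simp only [toggleRow]
            omega⟩
  left_inv lam := by
    have hlam : ∀ i, (nu.rowLen i ≤ lam.1.rowLen i ∧ lam.1.rowLen (i + 1) ≤ nu.rowLen i) ∧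
        mu.rowLen i ≤ lam.1.rowLen i ∧ lam.1.rowLen (i + 1) ≤ mu.rowLen i := fun i =>
      ⟨isHorizontalStrip_iff_rowLen.1 lam.2.1 i, isHorizontalStrip_iff_rowLen.1 lam.2.2 i⟩
    refine Subtype.ext (ext_rowLen fun i => ?_)
    rw [rowLen_ofRowLen]
    cases i with
    | zero =>
      have := hlam 0
      simp only [toggleRow]
      omega
    | succ i =>
      have := hlam i; have := hlam (i + 1)
      simp only [toggleRow, rowLen_ofRowLen]
      omega
  right_inv p := by
    have hkap : ∀ i, (p.1.1.rowLen i ≤ nu.rowLen i ∧ nu.rowLen (i + 1) ≤ p.1.1.rowLen i) ∧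
        p.1.1.rowLen i ≤ mu.rowLen i ∧ mu.rowLen (i + 1) ≤ p.1.1.rowLen i := fun i =>
      ⟨isHorizontalStrip_iff_rowLen.1 p.1.2.1 i, isHorizontalStrip_iff_rowLen.1 p.1.2.2 i⟩
    refine Prod.ext (Subtype.ext (ext_rowLen fun i => ?_)) ?_
    · simp only [rowLen_ofRowLen, toggleRow]
      have := hkap i; have := hkap (i + 1)
      omega
    · simp only [rowLen_ofRowLen, toggleRow]
      omega

theorem card_toggleEquiv {mu nu : YoungDiagram}
    (lam : {lam : YoungDiagram // IsHorizontalStrip lam nu ∧ IsHorizontalStrip lam mu}) :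
    lam.1.card + (toggleEquiv mu nu lam).1.1.card =
      mu.card + nu.card + (toggleEquiv mu nu lam).2 := by
  have hlam : ∀ i, (nu.rowLen i ≤ lam.1.rowLen i ∧ lam.1.rowLen (i + 1) ≤ nu.rowLen i) ∧
      mu.rowLen i ≤ lam.1.rowLen i ∧ lam.1.rowLen (i + 1) ≤ mu.rowLen i := fun i =>
    ⟨isHorizontalStrip_iff_rowLen.1 lam.2.1 i, isHorizontalStrip_iff_rowLen.1 lam.2.2 i⟩
  have hrow : ∀ i, (toggleEquiv mu nu lam).1.1.rowLen i =
      min (mu.rowLen i) (nu.rowLen i) + max (mu.rowLen (i + 1)) (nu.rowLen (i + 1)) -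
        lam.1.rowLen (i + 1) := fun i => by
    simp only [toggleEquiv, Equiv.coe_fn_mk, rowLen_ofRowLen]
  have htop : (toggleEquiv mu nu lam).2 =
    lam.1.rowLen 0 - max (mu.rowLen 0) (nu.rowLen 0) := rfl
  obtain ⟨N, hN⟩ : ∃ N, mu.colLen 0 + nu.colLen 0 = N := ⟨_, rfl⟩
  have h1 : mu.rowLen N = 0 := rowLen_eq_zero_of_colLen_le (by omega)
  have h2 : nu.rowLen N = 0 := rowLen_eq_zero_of_colLen_le (by omega)
  have h1' := mu.rowLen_anti _ _ (Nat.le_succ N)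
  have h2' := nu.rowLen_anti _ _ (Nat.le_succ N)
  have hlN := hlam N
  simp only [Nat.succ_eq_add_one] at h1' h2'
  rw [card_eq_sum_rowLen lam.1 (N := N + 1) (by omega),
    card_eq_sum_rowLen mu (N := N + 1) (by omega),
    card_eq_sum_rowLen nu (N := N + 1) (by omega),
    card_eq_sum_rowLen (toggleEquiv mu nu lam).1.1 (N := N) (by rw [hrow]; omega),
    Finset.sum_range_succ', htop]
  have key : ∑ i ∈ Finset.range N, lam.1.rowLen (i + 1) +
      ∑ i ∈ Finset.range N, (toggleEquiv mu nu lam).1.1.rowLen i =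
      ∑ i ∈ Finset.range N, min (mu.rowLen i) (nu.rowLen i) +
        ∑ i ∈ Finset.range N, max (mu.rowLen (i + 1)) (nu.rowLen (i + 1)) := by
    rw [← Finset.sum_add_distrib, ← Finset.sum_add_distrib]
    refine Finset.sum_congr rfl fun i _ => ?_
    have := hlam i; have := hlam (i + 1)
    rw [hrow]
    omega
  have hmax := Finset.sum_range_succ' (fun i => max (mu.rowLen i) (nu.rowLen i)) N
  have hmin := Finset.sum_range_succ (fun i => min (mu.rowLen i) (nu.rowLen i)) N
  have htot : ∑ i ∈ Finset.range (N + 1), min (mu.rowLen i) (nu.rowLen i) +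
      ∑ i ∈ Finset.range (N + 1), max (mu.rowLen i) (nu.rowLen i) =
      ∑ i ∈ Finset.range (N + 1), mu.rowLen i + ∑ i ∈ Finset.range (N + 1), nu.rowLen i := by
    rw [← Finset.sum_add_distrib, ← Finset.sum_add_distrib]
    exact Finset.sum_congr rfl fun i _ => min_add_max _ _
  have := hlam 0
  simp only [h1, h2, min_self, add_zero] at hmin
  omega

/-! ### Cancellation between horizontal and vertical strips -/

/-- Diagrams between `nu` and `lam` whose upper part is a horizontal and whose lower part is a
vertical strip cancel in pairs when `nu ≠ lam`: in the last row in which `lam` and `nu` differ, both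
lengths `nu i` and `nu i + 1` are allowed. -/
theorem sum_strips_eq_zero {R : Type*} [CommRing R] (s : Finset YoungDiagram)
    {lam nu : YoungDiagram} (hne : nu ≠ lam)
    (hs : ∀ mu, mu ∈ s ↔ IsHorizontalStrip lam mu ∧
      IsHorizontalStrip mu.transpose nu.transpose) (y : R) :
    ∑ mu ∈ s, (-y) ^ (lam.card - mu.card) * y ^ (mu.card - nu.card) = 0 := by
  have hrow : ∀ mu, mu ∈ s ↔ ∀ i, (mu.rowLen i ≤ lam.rowLen i ∧ lam.rowLen (i + 1) ≤ mu.rowLen i) ∧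
      nu.rowLen i ≤ mu.rowLen i ∧ mu.rowLen i ≤ nu.rowLen i + 1 := fun mu => by
    rw [hs, isHorizontalStrip_iff_rowLen, isHorizontalStrip_transpose_iff_rowLen, ← forall_and]
  have hcard : ∀ mu ∈ s, nu.card ≤ mu.card ∧ mu.card ≤ lam.card := fun mu hmu =>
    ⟨card_le_card (YoungDiagram.transpose_le_iff.1 ((hs mu).1 hmu).2.1),
      card_le_card ((hs mu).1 hmu).1.1⟩
  -- `i` is the last row in which `nu` and `lam` differ
  obtain ⟨i, hi, hlast⟩ : ∃ i, nu.rowLen i ≠ lam.rowLen i ∧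
      ∀ j, i < j → nu.rowLen j = lam.rowLen j := by
    obtain ⟨i₀, hi₀⟩ : ∃ i, nu.rowLen i ≠ lam.rowLen i := by
      by_contra! h
      exact hne (ext_rowLen h)
    have hN : ∀ j, nu.colLen 0 + lam.colLen 0 ≤ j → nu.rowLen j = lam.rowLen j := fun j hj => by
      rw [rowLen_eq_zero_of_colLen_le (by omega), rowLen_eq_zero_of_colLen_le (by omega)]
    have hi₀N : i₀ ≤ nu.colLen 0 + lam.colLen 0 := by
      by_contra h
      exact hi₀ (hN _ (by omega))
    refine ⟨Nat.findGreatest (fun j => nu.rowLen j ≠ lam.rowLen j) (nu.colLen 0 + lam.colLen 0),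
      Nat.findGreatest_spec (P := fun j => nu.rowLen j ≠ lam.rowLen j) hi₀N hi₀, fun j hj => ?_⟩
    by_contra h
    rcases le_total (nu.colLen 0 + lam.colLen 0) j with h' | h'
    · exact h (hN j h')
    · exact Nat.findGreatest_is_greatest hj h' h
  let f : YoungDiagram → ℕ → ℕ := fun mu j =>
    if j = i then 2 * nu.rowLen i + 1 - mu.rowLen i else mu.rowLen j
  have hf : ∀ mu ∈ s, Antitone (f mu) := fun mu hmu => by
    refine antitone_nat_of_succ_le fun j => ?_
    have h1 := (hrow mu).1 hmu j
    have h2 := (hrow mu).1 hmu (j + 1)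
    have h3 := hlast (j + 1)
    have h4 := nu.rowLen_anti _ _ (Nat.le_succ j)
    have h5 := mu.rowLen_anti _ _ (Nat.le_succ j)
    simp only [Nat.succ_eq_add_one] at h4 h5
    by_cases hj : j = i
    · subst hj
      simp only [f, if_pos, if_neg (Nat.succ_ne_self j)]
      omega
    · by_cases hj' : j + 1 = i
      · subst hj'
        simp only [f, if_pos, if_neg hj]
        omega
      · simp only [f, if_neg hj, if_neg hj']
        omega
  obtain ⟨N, hN⟩ : ∃ N, N = lam.colLen 0 + i + 1 := ⟨_, rfl⟩
  have hmuN : ∀ mu ∈ s, mu.rowLen N = 0 := fun mu hmu => by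
    have h1 := (hrow mu).1 hmu N
    have h2 : lam.rowLen N = 0 := rowLen_eq_zero_of_colLen_le (by omega)
    omega
  have hfN : ∀ mu ∈ s, f mu N = 0 := fun mu hmu => by
    simp only [f, if_neg (show N ≠ i by omega)]
    exact hmuN mu hmu
  let g : ∀ mu ∈ s, YoungDiagram := fun mu hmu => ofRowLen (f mu) N (hf mu hmu) (hfN mu hmu)
  have hg : ∀ mu hmu j, (g mu hmu).rowLen j = f mu j := fun mu hmu j => rowLen_ofRowLen _ _ _ _ _
  have hgcard : ∀ mu hmu, (g mu hmu).card + mu.rowLen i =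
      mu.card + (2 * nu.rowLen i + 1 - mu.rowLen i) := fun mu hmu => by
    have hiN : i ∈ Finset.range N := Finset.mem_range.2 (by omega)
    have h : ∑ j ∈ (Finset.range N).erase i, (g mu hmu).rowLen j =
        ∑ j ∈ (Finset.range N).erase i, mu.rowLen j :=
      Finset.sum_congr rfl fun j hj => (hg mu hmu j).trans (if_neg (Finset.ne_of_mem_erase hj))
    rw [card_eq_sum_rowLen mu (hmuN mu hmu),
      card_eq_sum_rowLen (g mu hmu) ((hg mu hmu N).trans (hfN mu hmu)),
      ← Finset.add_sum_erase _ _ hiN, ← Finset.add_sum_erase _ mu.rowLen hiN, h, hg mu hmu]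
    simp only [f, if_pos]
    omega
  have hgs : ∀ mu hmu, g mu hmu ∈ s := fun mu hmu => by
    rw [hrow]
    intro j
    have h1 := (hrow mu).1 hmu j
    rw [hg mu hmu]
    by_cases hj : j = i
    · subst hj
      have h3 := hlast (j + 1) (Nat.lt_succ_self j)
      have h4 := nu.rowLen_anti _ _ (Nat.le_succ j)
      simp only [Nat.succ_eq_add_one] at h4
      simp only [f, if_pos]
      omega
    · simpa only [f, if_neg hj] using h1
  refine Finset.sum_involution g ?_ ?_ hgs ?_
  · intro mu hmu
    have h1 := (hrow mu).1 hmu i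
    have h2 := hgcard mu hmu
    have h3 := hcard mu hmu
    have h4 := hcard _ (hgs mu hmu)
    rcases Nat.lt_or_ge (nu.rowLen i) (mu.rowLen i) with h | h
    · rw [show lam.card - (g mu hmu).card = lam.card - mu.card + 1 by omega,
        show mu.card - nu.card = (g mu hmu).card - nu.card + 1 by omega]
      ring
    · rw [show lam.card - mu.card = lam.card - (g mu hmu).card + 1 by omega,
        show (g mu hmu).card - nu.card = mu.card - nu.card + 1 by omega]
      ring
  · intro mu hmu _ h
    have h1 := hg mu hmu i
    rw [h] at h1
    have h2 := (hrow mu).1 hmu i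
    simp only [f, if_pos] at h1
    omega
  · intro mu hmu
    refine ext_rowLen fun j => ?_
    have h1 := (hrow mu).1 hmu j
    rw [hg _ (hgs mu hmu)]
    simp only [f, hg mu hmu]
    split_ifs with hj
    · subst hj
      omega
    · rfl

/-! ### The branching rule for semistandard fillings -/

theorem IsSemistandard.monotone {k : ℕ} {lam mu : YoungDiagram}
    {T : {c : ℕ × ℕ // c ∈ lam.cells \ mu.cells} → Fin k} (hT : IsSemistandard lam mu T) :
    Monotone T := by
  rintro ⟨⟨i, j⟩, hc⟩ ⟨⟨i', j'⟩, hd⟩ ⟨hi, hj⟩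
  change i ≤ i' at hi
  change j ≤ j' at hj
  -- move along row `i` first, then down column `j'`
  have he : (i, j') ∈ lam.cells \ mu.cells := by
    simp only [Finset.mem_sdiff, YoungDiagram.mem_cells] at hc hd ⊢
    exact ⟨lam.up_left_mem hi le_rfl hd.1, fun h => hc.2 (mu.up_left_mem le_rfl hj h)⟩
  have h1 : T ⟨(i, j), hc⟩ ≤ T ⟨(i, j'), he⟩ := by
    rcases hj.eq_or_lt with rfl | hj
    · exact le_rfl
    · exact hT.1 _ _ rfl hj
  have h2 : T ⟨(i, j'), he⟩ ≤ T ⟨(i', j'), hd⟩ := by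
    rcases hi.eq_or_lt with rfl | hi
    · exact le_rfl
    · exact (hT.2 ⟨(i, j'), he⟩ ⟨(i', j'), hd⟩ rfl hi).le
  exact h1.trans h2

open Classical in
/-- The skew Schur polynomial `s_{lam/mu}` evaluated at elements `x 0, …, x (k - 1)` of a
commutative ring. -/
noncomputable def skewSchurEval {A : Type*} [CommRing A] {k : ℕ} (x : Fin k → A)
    (lam mu : YoungDiagram) : A :=
  ∑ T : {T : {c : ℕ × ℕ // c ∈ lam.cells \ mu.cells} → Fin k // IsSemistandard lam mu T},
    ∏ c, x (T.1 c)

theorem aeval_skewSchur {A : Type*} [CommRing A] [Algebra ℤ A] {k : ℕ} (x : Fin k → A)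
    (lam mu : YoungDiagram) :
    MvPolynomial.aeval x (skewSchur k lam mu) = skewSchurEval x lam mu := by
  simp only [skewSchur, skewSchurEval, map_sum, map_prod, MvPolynomial.aeval_X]

open Classical in
theorem skewSchurEval_zero {A : Type*} [CommRing A] (x : Fin 0 → A) {lam mu : YoungDiagram}
    (h : mu ≤ lam) : skewSchurEval x lam mu = if lam = mu then 1 else 0 := by
  split_ifs with heq
  · subst heq
    have : IsEmpty {c : ℕ × ℕ // c ∈ lam.cells \ lam.cells} := ⟨fun c => by simpa using c.2⟩
    rw [skewSchurEval, Fintype.sum_eq_single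
      ⟨fun c => isEmptyElim c, fun c => isEmptyElim c, fun c => isEmptyElim c⟩]
    · simp
    · intro T hT
      exact absurd (Subsingleton.elim _ _) hT
  · obtain ⟨c, hc⟩ : (lam.cells \ mu.cells).Nonempty := by
      rw [Finset.sdiff_nonempty]
      exact fun h' => heq (le_antisymm (YoungDiagram.cells_subset_iff.1 h') h)
    exact Finset.sum_eq_zero fun T _ => (T.1 ⟨c, hc⟩).elim0

section Branching

variable {k : ℕ} {lam mu nu : YoungDiagram}

/-- Extends a filling of `nu / mu` to `lam / mu` by writing a new largest letter in `lam / nu`. -/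
def extendFilling (lam : YoungDiagram) (T : {c : ℕ × ℕ // c ∈ nu.cells \ mu.cells} → Fin k) :
    {c : ℕ × ℕ // c ∈ lam.cells \ mu.cells} → Fin (k + 1) := fun c =>
  if h : c.1 ∈ nu.cells \ mu.cells then (T ⟨c.1, h⟩).castSucc else Fin.last k

theorem isSemistandard_extendFilling (hs : IsHorizontalStrip lam nu)
    {T : {c : ℕ × ℕ // c ∈ nu.cells \ mu.cells} → Fin k} (hT : IsSemistandard nu mu T) :
    IsSemistandard lam mu (extendFilling lam T) := by
  constructor
  · rintro ⟨⟨i, j⟩, hc⟩ ⟨⟨i', j'⟩, hd⟩ hi hj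
    change i = i' at hi
    subst hi
    change j < j' at hj
    by_cases h : (i, j') ∈ nu.cells \ mu.cells
    · have h' : (i, j) ∈ nu.cells \ mu.cells := by
        simp only [Finset.mem_sdiff, YoungDiagram.mem_cells] at hc h ⊢
        exact ⟨nu.up_left_mem le_rfl hj.le h.1, hc.2⟩
      simp only [extendFilling, h, h', dif_pos, Fin.castSucc_le_castSucc_iff]
      exact hT.1 _ _ rfl hj
    · simp only [extendFilling, h, dif_neg, not_false_iff]
      exact Fin.le_last _
  · rintro ⟨⟨i, j⟩, hc⟩ ⟨⟨i', j'⟩, hd⟩ hj hi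
    change j = j' at hj
    subst hj
    change i < i' at hi
    have h' : (i, j) ∈ nu.cells \ mu.cells := by
      simp only [Finset.mem_sdiff, YoungDiagram.mem_cells] at hc hd ⊢
      exact ⟨hs.2 i j (lam.up_left_mem hi le_rfl hd.1), hc.2⟩
    by_cases h : (i', j) ∈ nu.cells \ mu.cells
    · simp only [extendFilling, h, h', dif_pos, Fin.castSucc_lt_castSucc_iff]
      exact hT.2 _ _ rfl hi
    · simp only [extendFilling, h, h', dif_neg, dif_pos, not_false_iff]
      exact Fin.castSucc_lt_last _

theorem prod_extendFilling {A : Type*} [CommRing A] (x : Fin (k + 1) → A) (h1 : mu ≤ nu)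
    (h2 : nu ≤ lam) (T : {c : ℕ × ℕ // c ∈ nu.cells \ mu.cells} → Fin k) :
    ∏ c, x (extendFilling lam T c) =
      x (Fin.last k) ^ (lam.card - nu.card) * ∏ c, x (T c).castSucc := by
  let F : ℕ × ℕ → A := fun c =>
    if h : c ∈ nu.cells \ mu.cells then x (T ⟨c, h⟩).castSucc else x (Fin.last k)
  have hF : ∀ c, x (extendFilling lam T c) = F c.1 := fun c => by
    simp only [extendFilling, F]
    split_ifs <;> rfl
  have hF' : ∀ c, x (T c).castSucc = F c.1 := fun c => by
    simp only [F, c.2, dif_pos]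
  have h1' := YoungDiagram.cells_subset_iff.2 h1
  have h2' := YoungDiagram.cells_subset_iff.2 h2
  rw [Finset.prod_congr rfl fun c _ => hF c, Finset.prod_congr rfl fun c _ => hF' c,
    Finset.prod_coe_sort (lam.cells \ mu.cells) F, Finset.prod_coe_sort (nu.cells \ mu.cells) F,
    ← Finset.prod_sdiff (Finset.sdiff_subset_sdiff h2' (Finset.Subset.refl mu.cells))]
  congr 1
  have hset : (lam.cells \ mu.cells) \ (nu.cells \ mu.cells) = lam.cells \ nu.cells := by
    ext c
    have := @h1' c
    simp only [Finset.mem_sdiff]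
    tauto
  rw [hset, Finset.prod_congr rfl (g := fun _ => x (Fin.last k)), Finset.prod_const,
    Finset.card_sdiff_of_subset h2']
  intro c hc
  have : c ∉ nu.cells \ mu.cells := fun h =>
    (Finset.mem_sdiff.1 hc).2 (Finset.mem_sdiff.1 h).1
  simp only [F, this, dif_neg, not_false_iff]

open Classical in
/-- For `mu ⊆ lam`, the diagram formed by `mu` and the cells of `lam / mu` that do not carry the
largest letter. -/
noncomputable def innerShape
    (T : {T : {c : ℕ × ℕ // c ∈ lam.cells \ mu.cells} → Fin (k + 1) // IsSemistandard lam mu T}) :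
    YoungDiagram where
  cells := lam.cells.filter fun c =>
    ∀ h : c ∈ lam.cells \ mu.cells, T.1 ⟨c, h⟩ ≠ Fin.last k
  isLowerSet := by
    intro c d hdc hc
    simp only [Finset.coe_filter, YoungDiagram.mem_cells, Set.mem_ofPred_eq] at hc ⊢
    refine ⟨lam.up_left_mem hdc.1 hdc.2 hc.1, fun h h' => ?_⟩
    have hcm : c ∈ lam.cells \ mu.cells := by
      simp only [Finset.mem_sdiff, YoungDiagram.mem_cells] at h ⊢
      exact ⟨hc.1, fun h' => h.2 (mu.up_left_mem hdc.1 hdc.2 h')⟩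
    have hle : T.1 ⟨d, h⟩ ≤ T.1 ⟨c, hcm⟩ := T.2.monotone hdc
    rw [h'] at hle
    exact hc.2 hcm (le_antisymm (Fin.le_last _) hle)

theorem mem_innerShape
    (T : {T : {c : ℕ × ℕ // c ∈ lam.cells \ mu.cells} → Fin (k + 1) // IsSemistandard lam mu T})
    {c : ℕ × ℕ} : c ∈ innerShape T ↔
      c ∈ lam ∧ ∀ h : c ∈ lam.cells \ mu.cells, T.1 ⟨c, h⟩ ≠ Fin.last k := by
  classical
  rw [← YoungDiagram.mem_cells, innerShape, Finset.mem_filter, YoungDiagram.mem_cells]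

theorem le_innerShape (hmu : mu ≤ lam)
    (T : {T : {c : ℕ × ℕ // c ∈ lam.cells \ mu.cells} → Fin (k + 1) // IsSemistandard lam mu T}) :
    mu ≤ innerShape T := fun c hc => by
  rw [mem_innerShape]
  exact ⟨hmu hc, fun h => absurd hc (by simpa using (Finset.mem_sdiff.1 h).2)⟩

theorem isHorizontalStrip_innerShape
    (T : {T : {c : ℕ × ℕ // c ∈ lam.cells \ mu.cells} → Fin (k + 1) // IsSemistandard lam mu T}) :
    IsHorizontalStrip lam (innerShape T) := by
  refine ⟨fun c hc => ((mem_innerShape T).1 hc).1, fun i j hij => ?_⟩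
  have hij' := lam.up_left_mem (Nat.le_succ i) (le_refl j) hij
  refine (mem_innerShape T).2 ⟨hij', fun h h' => ?_⟩
  have hd : (i + 1, j) ∈ lam.cells \ mu.cells := by
    simp only [Finset.mem_sdiff, YoungDiagram.mem_cells] at h ⊢
    exact ⟨hij, fun h' => h.2 (mu.up_left_mem (Nat.le_succ i) le_rfl h')⟩
  have := T.2.2 ⟨(i, j), h⟩ ⟨(i + 1, j), hd⟩ rfl (Nat.lt_succ_self i)
  rw [h'] at this
  exact absurd this (Fin.le_last _).not_gt

theorem innerShape_extendFilling (h1 : mu ≤ nu) (h2 : nu ≤ lam)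
    {T : {c : ℕ × ℕ // c ∈ nu.cells \ mu.cells} → Fin k}
    (hT : IsSemistandard lam mu (extendFilling lam T)) :
    innerShape ⟨extendFilling lam T, hT⟩ = nu := by
  ext c
  rw [YoungDiagram.mem_cells, YoungDiagram.mem_cells, mem_innerShape]
  constructor
  · rintro ⟨hc, h⟩
    by_contra hcn
    have hcm : c ∈ lam.cells \ mu.cells := by
      simp only [Finset.mem_sdiff, YoungDiagram.mem_cells]
      exact ⟨hc, fun h' => hcn (h1 h')⟩
    refine h hcm (dif_neg fun h' => hcn ?_)
    simpa using (Finset.mem_sdiff.1 h').1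
  · refine fun hc => ⟨h2 hc, fun h => ?_⟩
    have hcn : c ∈ nu.cells \ mu.cells := by
      simp only [Finset.mem_sdiff, YoungDiagram.mem_cells] at h ⊢
      exact ⟨hc, h.2⟩
    simp only [extendFilling, hcn, dif_pos]
    exact (Fin.castSucc_lt_last _).ne

theorem extendFilling_injective (h2 : nu ≤ lam) :
    Function.Injective (extendFilling (k := k) (mu := mu) (nu := nu) lam) := by
  intro T T' h
  funext c
  have hc : c.1 ∈ lam.cells \ mu.cells :=
    Finset.sdiff_subset_sdiff (YoungDiagram.cells_subset_iff.2 h2) (Finset.Subset.refl _) c.2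
  have := congrFun h ⟨c.1, hc⟩
  simpa only [extendFilling, c.2, dif_pos, Fin.castSucc_inj] using this

theorem exists_extendFilling_eq
    (T : {T : {c : ℕ × ℕ // c ∈ lam.cells \ mu.cells} → Fin (k + 1) // IsSemistandard lam mu T})
    (hT : innerShape T = nu) :
    ∃ T' : {c : ℕ × ℕ // c ∈ nu.cells \ mu.cells} → Fin k,
      IsSemistandard nu mu T' ∧ extendFilling lam T' = T.1 := by
  have hmem : ∀ c, c ∈ nu ↔
      c ∈ lam ∧ ∀ h : c ∈ lam.cells \ mu.cells, T.1 ⟨c, h⟩ ≠ Fin.last k := fun c => by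
    rw [← hT, mem_innerShape]
  have hsub : ∀ c, c ∈ nu.cells \ mu.cells → c ∈ lam.cells \ mu.cells := fun c hc => by
    simp only [Finset.mem_sdiff, YoungDiagram.mem_cells, hmem] at hc ⊢
    exact ⟨hc.1.1, hc.2⟩
  have hne : ∀ c (hc : c ∈ nu.cells \ mu.cells), T.1 ⟨c, hsub c hc⟩ ≠ Fin.last k := fun c hc =>
    ((hmem c).1 (by simpa using (Finset.mem_sdiff.1 hc).1)).2 _
  refine ⟨fun c => (T.1 ⟨c.1, hsub c.1 c.2⟩).castPred (hne c.1 c.2), ⟨?_, ?_⟩, ?_⟩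
  · intro c d h1 h2
    exact Fin.castPred_le_castPred_iff.2 (T.2.1 _ _ h1 h2)
  · intro c d h1 h2
    exact Fin.castPred_lt_castPred_iff.2 (T.2.2 _ _ h1 h2)
  · funext c
    by_cases hc : c.1 ∈ nu.cells \ mu.cells
    · simp only [extendFilling, hc, dif_pos, Fin.castSucc_castPred]
    · simp only [extendFilling, hc, dif_neg, not_false_iff]
      by_contra hlast
      refine hc ?_
      have := c.2
      simp only [Finset.mem_sdiff, YoungDiagram.mem_cells, hmem] at this ⊢
      exact ⟨⟨this.1, fun _ h => hlast h.symm⟩, this.2⟩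

open Classical in
/-- The branching rule: splitting off the cells that carry the largest letter. -/
theorem skewSchurEval_succ {A : Type*} [CommRing A] (x : Fin (k + 1) → A) (hmu : mu ≤ lam) :
    skewSchurEval x lam mu =
      ∑ nu ∈ (finite_subdiagrams lam).toFinset with mu ≤ nu ∧ IsHorizontalStrip lam nu,
        x (Fin.last k) ^ (lam.card - nu.card) *
          skewSchurEval (fun i => x i.castSucc) nu mu := by
  rw [skewSchurEval, ← Finset.sum_fiberwise_of_maps_to (g := innerShape)
    (t := {nu ∈ (finite_subdiagrams lam).toFinset | mu ≤ nu ∧ IsHorizontalStrip lam nu})]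
  · refine Finset.sum_congr rfl fun nu hnu => ?_
    obtain ⟨hle, hmunu, hstrip⟩ := by simpa using hnu
    rw [skewSchurEval, Finset.mul_sum]
    symm
    refine Finset.sum_bij
      (fun T _ => ⟨extendFilling lam T.1, isSemistandard_extendFilling hstrip T.2⟩) ?_ ?_ ?_ ?_
    · intro T _
      exact Finset.mem_filter.2 ⟨Finset.mem_univ _, innerShape_extendFilling hmunu hle _⟩
    · intro T _ T' _ h
      exact Subtype.ext (extendFilling_injective hle (congrArg Subtype.val h))
    · intro T hT
      obtain ⟨T', h1, h2⟩ := exists_extendFilling_eq T (Finset.mem_filter.1 hT).2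
      exact ⟨⟨T', h1⟩, Finset.mem_univ _, Subtype.ext h2⟩
    · intro T _
      exact (prod_extendFilling x hmunu hle T.1).symm
  · intro T _
    have := isHorizontalStrip_innerShape T
    simpa using ⟨this.1, le_innerShape hmu T, this⟩

end Branching

/-! ### Summation of graded families of power series -/

section Graded

variable {σ : Type*}

theorem summable_of_finite_order_le {ι : Type*} {f : ι → MvPowerSeries σ ℤ}
    (h : ∀ d : ℕ, {i | f i ≠ 0 ∧ (f i).order ≤ d}.Finite) : Summable f := by
  rw [MvPowerSeries.WithPiTopology.summable_iff_summable_coeff]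
  intro d
  refine summable_of_hasFiniteSupport ((h d.degree).subset fun i hi => ⟨?_, ?_⟩)
  · rintro h0
    simp [h0] at hi
  · exact MvPowerSeries.order_le hi

theorem summable_of_card_le {f : YoungDiagram → MvPowerSeries σ ℤ} (c : ℕ)
    (h : ∀ lam, f lam ≠ 0 → (lam.card : ℕ∞) ≤ (f lam).order + c) : Summable f := by
  refine summable_of_finite_order_le fun d => (finite_card_le (d + c)).subset ?_
  rintro lam ⟨h0, hd⟩
  have := (h lam h0).trans (add_le_add_left hd _)
  exact_mod_cast this

theorem summable_uncurry_of_card_le {f : YoungDiagram → YoungDiagram → MvPowerSeries σ ℤ}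
    (h : ∀ lam mu, f lam mu ≠ 0 → (lam.card : ℕ∞) ≤ (f lam mu).order ∧ mu.card ≤ lam.card) :
    Summable (Function.uncurry f) := by
  refine summable_of_finite_order_le fun d =>
    ((finite_card_le d).prod (finite_card_le d)).subset ?_
  rintro ⟨lam, mu⟩ ⟨h0, hd⟩
  obtain ⟨h1, h2⟩ := h lam mu h0
  have h3 : lam.card ≤ d := by exact_mod_cast h1.trans hd
  exact ⟨h3, h2.trans h3⟩

/-- A matrix indexed by Young diagrams is graded if its entry at `(lam, mu)` vanishes unless
`mu ⊆ lam` and has order at least `|lam| - |mu|`. -/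
structure IsGradedMatrix (M : YoungDiagram → YoungDiagram → MvPowerSeries σ ℤ) : Prop where
  le_of_ne_zero : ∀ {lam mu}, M lam mu ≠ 0 → mu ≤ lam
  card_le : ∀ lam mu, (lam.card : ℕ∞) ≤ (M lam mu).order + mu.card

/-- A family indexed by Young diagrams is graded if its entry at `lam` has order at least
`|lam|`. -/
def IsGraded (S : YoungDiagram → MvPowerSeries σ ℤ) : Prop :=
  ∀ lam, (lam.card : ℕ∞) ≤ (S lam).order

theorem IsGraded.summable {S : YoungDiagram → MvPowerSeries σ ℤ} (hS : IsGraded S) : Summable S :=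
  summable_of_card_le 0 fun lam _ => by simpa using hS lam

/-- The operator `S ↦ (lam ↦ ∑_{mu ⊆ lam} M lam mu * S mu)` of a graded matrix. -/
noncomputable def up (M : YoungDiagram → YoungDiagram → MvPowerSeries σ ℤ)
    (S : YoungDiagram → MvPowerSeries σ ℤ) (lam : YoungDiagram) : MvPowerSeries σ ℤ :=
  ∑' mu, M lam mu * S mu

/-- The transposed operator `S ↦ (mu ↦ ∑_{lam ⊇ mu} M lam mu * S lam)` of a graded matrix. -/
noncomputable def down (M : YoungDiagram → YoungDiagram → MvPowerSeries σ ℤ)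
    (S : YoungDiagram → MvPowerSeries σ ℤ) (mu : YoungDiagram) : MvPowerSeries σ ℤ :=
  ∑' lam, M lam mu * S lam

variable {M N : YoungDiagram → YoungDiagram → MvPowerSeries σ ℤ}
  {S : YoungDiagram → MvPowerSeries σ ℤ}

theorem IsGradedMatrix.summable_row (hM : IsGradedMatrix M) (lam : YoungDiagram)
    (A : YoungDiagram → MvPowerSeries σ ℤ) : Summable fun mu => M lam mu * A mu := by
  refine summable_of_hasFiniteSupport ((finite_subdiagrams lam).subset fun mu hmu => ?_)
  exact hM.le_of_ne_zero (left_ne_zero_of_mul hmu)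

theorem IsGradedMatrix.summable_col (hM : IsGradedMatrix M) (mu : YoungDiagram)
    (A : YoungDiagram → MvPowerSeries σ ℤ) : Summable fun lam => A lam * M lam mu :=
  summable_of_card_le mu.card fun lam _ => (hM.card_le lam mu).trans
    (add_le_add_left (le_add_self.trans MvPowerSeries.le_order_mul) _)

theorem IsGraded.summable_mul (hS : IsGraded S) (A : YoungDiagram → MvPowerSeries σ ℤ) :
    Summable fun lam => A lam * S lam :=
  summable_of_card_le 0 fun lam _ => by
    simpa using (hS lam).trans (le_add_self.trans MvPowerSeries.le_order_mul)

theorem up_eq_sum (hM : IsGradedMatrix M) (lam : YoungDiagram) :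
    up M S lam = ∑ mu ∈ (finite_subdiagrams lam).toFinset, M lam mu * S mu := by
  refine tsum_eq_sum fun mu hmu => ?_
  by_contra h
  exact hmu (by simpa using hM.le_of_ne_zero (left_ne_zero_of_mul h))

theorem card_le_order_up (hM : IsGradedMatrix M) (c : ℕ)
    (hS : ∀ mu, (mu.card : ℕ∞) ≤ (S mu).order + c) (lam : YoungDiagram) :
    (lam.card : ℕ∞) ≤ (up M S lam).order + c := by
  rw [up_eq_sum hM, ← tsub_le_iff_right]
  refine MvPowerSeries.le_order fun d hd => ?_
  rw [map_sum]
  refine Finset.sum_eq_zero fun mu _ => MvPowerSeries.coeff_of_lt_order (hd.trans_le ?_)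
  rw [tsub_le_iff_right]
  calc (lam.card : ℕ∞) ≤ (M lam mu).order + mu.card := hM.card_le lam mu
    _ ≤ (M lam mu).order + ((S mu).order + c) := add_le_add_right (hS mu) _
    _ ≤ (M lam mu * S mu).order + c := by
      rw [← add_assoc]
      exact add_le_add_left MvPowerSeries.le_order_mul _

theorem IsGraded.up (hM : IsGradedMatrix M) (hS : IsGraded S) : IsGraded (up M S) := fun lam => by
  simpa using card_le_order_up hM 0 (fun mu => by simpa using hS mu) lam

theorem IsGraded.down (hM : IsGradedMatrix M) (hS : IsGraded S) : IsGraded (down M S) :=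
  fun mu => by
  refine MvPowerSeries.le_order fun d hd => ?_
  have h := MvPowerSeries.WithPiTopology.hasSum_iff_hasSum_coeff.1
    (hS.summable_mul fun lam => M lam mu).hasSum d
  refine h.unique ?_
  convert hasSum_zero using 2 with lam
  by_cases h0 : M lam mu = 0
  · simp [h0]
  · have h1 : (mu.card : ℕ∞) ≤ lam.card := by exact_mod_cast card_le_card (hM.le_of_ne_zero h0)
    exact MvPowerSeries.coeff_of_lt_order (hd.trans_le (h1.trans ((hS lam).trans
      (le_add_self.trans MvPowerSeries.le_order_mul))))

theorem tsum_mul_up (hM : IsGradedMatrix M) (hS : IsGraded S)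
    (A : YoungDiagram → MvPowerSeries σ ℤ) :
    ∑' lam, A lam * up M S lam = ∑' mu, (∑' lam, A lam * M lam mu) * S mu := by
  have hsum : Summable (Function.uncurry fun lam mu => A lam * (M lam mu * S mu)) := by
    refine summable_uncurry_of_card_le fun lam mu h0 => ⟨?_, ?_⟩
    · calc (lam.card : ℕ∞) ≤ (M lam mu).order + mu.card := hM.card_le lam mu
        _ ≤ (M lam mu).order + (S mu).order := add_le_add_right (hS mu) _
        _ ≤ (M lam mu * S mu).order := MvPowerSeries.le_order_mul
        _ ≤ (A lam * (M lam mu * S mu)).order := le_add_self.trans MvPowerSeries.le_order_mul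
    · exact card_le_card (hM.le_of_ne_zero (left_ne_zero_of_mul (right_ne_zero_of_mul h0)))
  calc ∑' lam, A lam * up M S lam = ∑' lam, ∑' mu, A lam * (M lam mu * S mu) :=
        tsum_congr fun lam => ((hM.summable_row lam S).tsum_mul_left _).symm
    _ = ∑' mu, ∑' lam, A lam * (M lam mu * S mu) := hsum.tsum_comm.symm
    _ = ∑' mu, (∑' lam, A lam * M lam mu) * S mu := tsum_congr fun mu => by
        rw [← (hM.summable_col mu A).tsum_mul_right]
        exact tsum_congr fun lam => (mul_assoc _ _ _).symm

theorem tsum_mul_down (hM : IsGradedMatrix M) (hS : IsGraded S)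
    (A : YoungDiagram → MvPowerSeries σ ℤ) :
    ∑' kap, A kap * down M S kap = ∑' mu, (∑' kap, M mu kap * A kap) * S mu := by
  have hsum : Summable (Function.uncurry fun mu kap => M mu kap * A kap * S mu) := by
    refine summable_uncurry_of_card_le fun mu kap h0 => ⟨?_, ?_⟩
    · exact (hS mu).trans (le_add_self.trans MvPowerSeries.le_order_mul)
    · exact card_le_card (hM.le_of_ne_zero (left_ne_zero_of_mul (left_ne_zero_of_mul h0)))
  calc ∑' kap, A kap * down M S kap = ∑' kap, ∑' mu, M mu kap * A kap * S mu :=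
        tsum_congr fun kap => by
          rw [down, ← (hS.summable_mul fun mu => M mu kap).tsum_mul_left]
          exact tsum_congr fun mu => by ring
    _ = ∑' mu, ∑' kap, M mu kap * A kap * S mu := hsum.tsum_comm
    _ = ∑' mu, (∑' kap, M mu kap * A kap) * S mu := tsum_congr fun mu =>
        (hM.summable_row mu A).tsum_mul_right _

/-- A commutation relation between a lowering and a raising matrix passes to their operators. -/
theorem mul_down_up (hM : IsGradedMatrix M) (hN : IsGradedMatrix N) (hS : IsGraded S)
    (c : MvPowerSeries σ ℤ)
    (h : ∀ mu nu, c * ∑' lam, N lam nu * M lam mu = ∑' kap, N mu kap * M nu kap)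
    (nu : YoungDiagram) : c * down N (up M S) nu = up M (down N S) nu := by
  rw [down, tsum_mul_up hM hS fun lam => N lam nu, up, tsum_mul_down hN hS (M nu),
    ← (hS.summable_mul _).tsum_mul_left]
  exact tsum_congr fun mu => by rw [← h mu nu, mul_assoc]

theorem mul_tsum_up (hM : IsGradedMatrix M) (hS : IsGraded S) (c : MvPowerSeries σ ℤ)
    (h : ∀ mu, c * ∑' lam, M lam mu = ∑' kap, M mu kap) :
    c * ∑' lam, up M S lam = ∑' kap, down M S kap := by
  have h1 := tsum_mul_up hM hS fun _ => 1
  have h2 := tsum_mul_down hM hS fun _ => 1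
  simp only [one_mul, mul_one] at h1 h2
  rw [h1, h2, ← (hS.summable_mul _).tsum_mul_left]
  exact tsum_congr fun mu => by rw [← h mu, mul_assoc]

theorem up_mul_left (hM : IsGradedMatrix M) (c : MvPowerSeries σ ℤ) (lam : YoungDiagram) :
    up M (fun mu => c * S mu) lam = c * up M S lam := by
  rw [up, up, ← (hM.summable_row lam S).tsum_mul_left]
  exact tsum_congr fun mu => mul_left_comm _ _ _

theorem down_mul_left (hS : IsGraded S) (c : MvPowerSeries σ ℤ) (mu : YoungDiagram) :
    down M (fun lam => c * S lam) mu = c * down M S mu := by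
  rw [down, down, ← (hS.summable_mul fun lam => M lam mu).tsum_mul_left]
  exact tsum_congr fun lam => mul_left_comm _ _ _

end Graded

/-! ### The commutation relations of strip matrices -/

section Strips

variable {σ : Type*}

open Classical in
/-- The matrix with entries `t ^ (|lam| - |mu|)` at the horizontal strips `lam / mu`,
and `0` elsewhere. -/
noncomputable def hStrip (t : MvPowerSeries σ ℤ) (lam mu : YoungDiagram) : MvPowerSeries σ ℤ :=
  if IsHorizontalStrip lam mu then t ^ (lam.card - mu.card) else 0

/-- The matrix with entries `t ^ (|lam| - |mu|)` at the vertical strips `lam / mu`, and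
`0` elsewhere. -/
noncomputable def vStrip (t : MvPowerSeries σ ℤ) (lam mu : YoungDiagram) : MvPowerSeries σ ℤ :=
  hStrip t lam.transpose mu.transpose

theorem isGradedMatrix_hStrip {t : MvPowerSeries σ ℤ} (ht : t.constantCoeff = 0) :
    IsGradedMatrix (hStrip t) where
  le_of_ne_zero h := by
    by_contra h'
    exact h (if_neg fun hs => h' hs.1)
  card_le lam mu := by
    rw [hStrip]
    split_ifs
    · have h1 := MvPowerSeries.le_order_pow_of_constantCoeff_eq_zero (lam.card - mu.card) ht
      refine le_trans ?_ (add_le_add_left h1 _)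
      exact_mod_cast le_tsub_add
    · simp

theorem isGradedMatrix_vStrip {t : MvPowerSeries σ ℤ} (ht : t.constantCoeff = 0) :
    IsGradedMatrix (vStrip t) where
  le_of_ne_zero h := YoungDiagram.transpose_le_iff.1 ((isGradedMatrix_hStrip ht).le_of_ne_zero h)
  card_le lam mu := by
    simpa only [card_transpose, vStrip] using
      (isGradedMatrix_hStrip ht).card_le lam.transpose mu.transpose

/-- Cauchy's identity for a pair of variables, in its skew form. -/
theorem mul_tsum_hStrip_mul_hStrip {a b : MvPowerSeries σ ℤ} (hab : (a * b).constantCoeff = 0)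
    (mu nu : YoungDiagram) :
    (1 - a * b) * ∑' lam, hStrip b lam nu * hStrip a lam mu =
      ∑' kap, hStrip b mu kap * hStrip a nu kap := by
  let P : Set YoungDiagram := {lam | IsHorizontalStrip lam nu ∧ IsHorizontalStrip lam mu}
  let Q : Set YoungDiagram := {kap | IsHorizontalStrip nu kap ∧ IsHorizontalStrip mu kap}
  have hQ : Finite Q := ((finite_subdiagrams nu).subset fun kap hkap => hkap.1.1).to_subtype
  let G : Q → MvPowerSeries σ ℤ := fun kap =>
    b ^ (mu.card - kap.1.card) * a ^ (nu.card - kap.1.card)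
  have hP : ∑' lam, hStrip b lam nu * hStrip a lam mu =
      ∑' lam : P, b ^ (lam.1.card - nu.card) * a ^ (lam.1.card - mu.card) := by
    rw [tsum_subtype P fun lam => b ^ (lam.card - nu.card) * a ^ (lam.card - mu.card)]
    refine tsum_congr fun lam => ?_
    by_cases h : lam ∈ P
    · rw [Set.indicator_of_mem h, hStrip, hStrip, if_pos h.1, if_pos h.2]
    · rw [Set.indicator_of_notMem h, hStrip, hStrip]
      split_ifs with h1 h2
      · exact absurd ⟨h1, h2⟩ h
      all_goals simp
  have hQ' : ∑' kap, hStrip b mu kap * hStrip a nu kap = ∑' kap : Q, G kap := by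
    rw [tsum_subtype Q fun kap => b ^ (mu.card - kap.card) * a ^ (nu.card - kap.card)]
    refine tsum_congr fun kap => ?_
    by_cases h : kap ∈ Q
    · rw [Set.indicator_of_mem h, hStrip, hStrip, if_pos h.1, if_pos h.2]
    · rw [Set.indicator_of_notMem h, hStrip, hStrip]
      split_ifs with h1 h2
      · exact absurd ⟨h2, h1⟩ h
      all_goals simp
  have hsum : Summable fun p : Q × ℕ => G p.1 * (a * b) ^ p.2 := by
    refine summable_of_finite_order_le fun d =>
      ((Set.finite_univ (α := Q)).prod (Set.finite_Iic d)).subset ?_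
    rintro ⟨kap, k⟩ ⟨-, hd⟩
    refine ⟨Set.mem_univ _, ?_⟩
    have := (MvPowerSeries.le_order_pow_of_constantCoeff_eq_zero k hab).trans
      (le_add_self.trans (MvPowerSeries.le_order_mul (f := G kap)))
    exact_mod_cast this.trans hd
  have htoggle : ∑' lam : P, b ^ (lam.1.card - nu.card) * a ^ (lam.1.card - mu.card) =
      ∑' p : Q × ℕ, G p.1 * (a * b) ^ p.2 := by
    let e : P ≃ Q × ℕ := toggleEquiv mu nu
    rw [← e.tsum_eq]
    refine tsum_congr fun lam => ?_
    have h1 := card_toggleEquiv lam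
    have h2 := card_le_card lam.2.1.1
    have h3 := card_le_card lam.2.2.1
    have h4 := card_le_card (toggleEquiv mu nu lam).1.2.1.1
    have h5 := card_le_card (toggleEquiv mu nu lam).1.2.2.1
    simp only [G]
    rw [show lam.1.card - nu.card = mu.card - (toggleEquiv mu nu lam).1.1.card +
        (toggleEquiv mu nu lam).2 by omega,
      show lam.1.card - mu.card = nu.card - (toggleEquiv mu nu lam).1.1.card +
        (toggleEquiv mu nu lam).2 by omega]
    ring
  have hgeom := MvPowerSeries.WithPiTopology.summable_pow_of_constantCoeff_eq_zero hab
  rw [hP, hQ', htoggle, hsum.tsum_prod, tsum_congr fun kap => hgeom.tsum_mul_left (G kap),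
    Summable.tsum_mul_right _ (Summable.of_finite), mul_left_comm,
    MvPowerSeries.WithPiTopology.one_sub_mul_tsum_pow_of_constantCoeff_eq_zero hab, mul_one]

theorem mul_tsum_vStrip_mul_vStrip {a b : MvPowerSeries σ ℤ} (hab : (a * b).constantCoeff = 0)
    (mu nu : YoungDiagram) :
    (1 - a * b) * ∑' lam, vStrip b lam nu * vStrip a lam mu =
      ∑' kap, vStrip b mu kap * vStrip a nu kap := by
  have := mul_tsum_hStrip_mul_hStrip hab mu.transpose nu.transpose
  rwa [← YoungDiagram.transposeOrderIso.toEquiv.tsum_eq,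
    ← YoungDiagram.transposeOrderIso.toEquiv.tsum_eq (fun kap => hStrip b _ kap * _)] at this

/-- The case `mu = nu` of `mul_tsum_hStrip_mul_hStrip` with one of the two variables set to `1`. -/
theorem mul_tsum_hStrip {t : MvPowerSeries σ ℤ} (ht : t.constantCoeff = 0) (mu : YoungDiagram) :
    (1 - t) * ∑' lam, hStrip t lam mu = ∑' kap, hStrip t mu kap := by
  have := mul_tsum_hStrip_mul_hStrip (a := t) (b := 1) (by simpa using ht) mu mu
  have h : ∀ lam mu, hStrip 1 lam mu * hStrip t lam mu = hStrip t lam mu := fun lam mu => by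
    simp only [hStrip]
    split_ifs <;> simp
  simpa only [h, mul_one] using this

theorem mul_tsum_vStrip {t : MvPowerSeries σ ℤ} (ht : t.constantCoeff = 0) (mu : YoungDiagram) :
    (1 - t) * ∑' lam, vStrip t lam mu = ∑' kap, vStrip t mu kap := by
  have := mul_tsum_hStrip ht mu.transpose
  rwa [← YoungDiagram.transposeOrderIso.toEquiv.tsum_eq,
    ← YoungDiagram.transposeOrderIso.toEquiv.tsum_eq (fun kap => hStrip t _ kap)] at this

open Classical in
/-- The matrices of vertical strips in `y` and of horizontal strips in `-y` are inverse to each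
other. -/
theorem tsum_hStrip_neg_mul_vStrip (y : MvPowerSeries σ ℤ) (lam nu : YoungDiagram) :
    ∑' mu, hStrip (-y) lam mu * vStrip y mu nu = if lam = nu then 1 else 0 := by
  split_ifs with h
  · subst h
    rw [tsum_eq_single lam]
    · have h1 : IsHorizontalStrip lam lam := ⟨le_rfl, fun i j h =>
        lam.up_left_mem (Nat.le_succ i) le_rfl h⟩
      have h2 : IsHorizontalStrip lam.transpose lam.transpose := ⟨le_rfl, fun i j h =>
        lam.transpose.up_left_mem (Nat.le_succ i) le_rfl h⟩
      simp [hStrip, vStrip, h1, h2]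
    · intro mu hmu
      by_contra h0
      refine hmu (le_antisymm ?_ ?_)
      · by_contra h'
        have h1 : hStrip (-y) lam mu = 0 := if_neg fun hs => h' hs.1
        exact h0 (by rw [h1, zero_mul])
      · by_contra h'
        have h1 : vStrip y mu lam = 0 :=
          if_neg fun hs => h' (YoungDiagram.transpose_le_iff.1 hs.1)
        exact h0 (by rw [h1, mul_zero])
  · let s : Finset YoungDiagram := {mu ∈ (finite_subdiagrams lam).toFinset |
      IsHorizontalStrip lam mu ∧ IsHorizontalStrip mu.transpose nu.transpose}
    have hs : ∀ mu, mu ∈ s ↔ IsHorizontalStrip lam mu ∧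
        IsHorizontalStrip mu.transpose nu.transpose := fun mu => by
      simp only [s, Finset.mem_filter, Set.Finite.mem_toFinset, Set.mem_ofPred_eq,
        and_iff_right_iff_imp]
      exact fun h => h.1.1
    rw [← sum_strips_eq_zero s (Ne.symm h) hs y, tsum_eq_sum (s := s)]
    · refine Finset.sum_congr rfl fun mu hmu => ?_
      rw [hs] at hmu
      rw [vStrip, hStrip, hStrip, if_pos hmu.1, if_pos hmu.2, card_transpose, card_transpose]
    · intro mu hmu
      rw [hs, not_and_or] at hmu
      rw [vStrip, hStrip, hStrip]
      rcases hmu with h | h <;> simp [h]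

end Strips

/-! ### Adding variables one at a time -/

section Iterate

variable {σ : Type*}

/-- Applies the raising operators of the matrices `W (y 0), …, W (y (n - 1))` in this order. -/
noncomputable def iterUp
    (W : MvPowerSeries σ ℤ → YoungDiagram → YoungDiagram → MvPowerSeries σ ℤ) :
    (n : ℕ) → (Fin n → MvPowerSeries σ ℤ) → (YoungDiagram → MvPowerSeries σ ℤ) →
      YoungDiagram → MvPowerSeries σ ℤ
  | 0, _, S => S
  | n + 1, y, S => up (W (y (Fin.last n))) (iterUp W n (fun i => y i.castSucc) S)

/-- The product `∏_i (1 - y i) * ∏_{i<j} (1 - y i * y j)`, one `j` at a time. -/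
noncomputable def pairProduct : (n : ℕ) → (Fin n → MvPowerSeries σ ℤ) → MvPowerSeries σ ℤ
  | 0, _ => 1
  | n + 1, y => pairProduct n (fun i => y i.castSucc) *
      ((1 - y (Fin.last n)) * ∏ i : Fin n, (1 - y i.castSucc * y (Fin.last n)))

/-- A family of graded matrices for which the raising and lowering operators satisfy the
commutation relation of Cauchy's identity, and for which summing over all diagrams turns raising
into lowering up to the factor `1 - t`. -/
structure IsStripFamily
    (W : MvPowerSeries σ ℤ → YoungDiagram → YoungDiagram → MvPowerSeries σ ℤ) : Prop where
  isGradedMatrix : ∀ {t}, t.constantCoeff = 0 → IsGradedMatrix (W t)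
  comm : ∀ {a b}, (a * b).constantCoeff = 0 → ∀ mu nu,
    (1 - a * b) * ∑' lam, W b lam nu * W a lam mu = ∑' kap, W b mu kap * W a nu kap
  total : ∀ {t}, t.constantCoeff = 0 → ∀ mu, (1 - t) * ∑' lam, W t lam mu = ∑' kap, W t mu kap

theorem isStripFamily_hStrip : IsStripFamily (hStrip (σ := σ)) :=
  ⟨isGradedMatrix_hStrip, mul_tsum_hStrip_mul_hStrip, mul_tsum_hStrip⟩

theorem isStripFamily_vStrip : IsStripFamily (vStrip (σ := σ)) :=
  ⟨isGradedMatrix_vStrip, mul_tsum_vStrip_mul_vStrip, mul_tsum_vStrip⟩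

variable {W : MvPowerSeries σ ℤ → YoungDiagram → YoungDiagram → MvPowerSeries σ ℤ}
  {S : YoungDiagram → MvPowerSeries σ ℤ}

theorem IsGraded.iterUp (hW : IsStripFamily W) (hS : IsGraded S) :
    ∀ {n : ℕ} {y : Fin n → MvPowerSeries σ ℤ} (_ : ∀ i, (y i).constantCoeff = 0),
      IsGraded (iterUp W n y S)
  | 0, _, _ => hS
  | _ + 1, _, hy => (hS.iterUp hW fun i => hy i.castSucc).up (hW.isGradedMatrix (hy _))

/-- If `S` is an eigenvector of a lowering operator, then so is every family raised from `S`. -/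
theorem prod_mul_down_iterUp (hW : IsStripFamily W) (hS : IsGraded S) {t C : MvPowerSeries σ ℤ}
    (ht : t.constantCoeff = 0) (hC : ∀ nu, down (W t) S nu = C * S nu) :
    ∀ {n : ℕ} {y : Fin n → MvPowerSeries σ ℤ} (_ : ∀ i, (y i).constantCoeff = 0)
      (nu : YoungDiagram),
      (∏ i, (1 - y i * t)) * down (W t) (iterUp W n y S) nu = C * iterUp W n y S nu
  | 0, _, _, nu => by simpa [iterUp] using hC nu
  | n + 1, y, hy, nu => by
    -- move the lowering operator past the last raising operator, then past the others
    have hlast := hW.isGradedMatrix (hy (Fin.last n))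
    have hG : IsGraded (iterUp W n (fun i => y i.castSucc) S) :=
      hS.iterUp hW fun i => hy i.castSucc
    rw [iterUp, Fin.prod_univ_castSucc, mul_assoc, mul_down_up hlast (hW.isGradedMatrix ht) hG _
      (hW.comm (by rw [map_mul, ht, mul_zero])), ← up_mul_left hlast, ← up_mul_left hlast]
    refine congrArg (fun S => up _ S nu) (funext fun mu => ?_)
    exact prod_mul_down_iterUp hW hS ht hC (fun i => hy i.castSucc) mu

/-- Raising an eigenvector of all lowering operators multiplies the sum of its entries by the
eigenvalues and divides it by `pairProduct`. -/
theorem pairProduct_mul_tsum_iterUp (hW : IsStripFamily W) (hS : IsGraded S)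
    {C : MvPowerSeries σ ℤ → MvPowerSeries σ ℤ}
    (hC : ∀ {t}, t.constantCoeff = 0 → ∀ nu, down (W t) S nu = C t * S nu) :
    ∀ {n : ℕ} {y : Fin n → MvPowerSeries σ ℤ} (_ : ∀ i, (y i).constantCoeff = 0),
      pairProduct n y * ∑' lam, iterUp W n y S lam = (∏ i, C (y i)) * ∑' lam, S lam
  | 0, _, _ => by simp [pairProduct, iterUp]
  | n + 1, y, hy => by
    have hlast := hW.isGradedMatrix (hy (Fin.last n))
    have hG : IsGraded (iterUp W n (fun i => y i.castSucc) S) :=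
      hS.iterUp hW fun i => hy i.castSucc
    have hdown : (∏ i : Fin n, (1 - y i.castSucc * y (Fin.last n))) *
        ∑' nu, down (W (y (Fin.last n))) (iterUp W n (fun i => y i.castSucc) S) nu =
        C (y (Fin.last n)) * ∑' nu, iterUp W n (fun i => y i.castSucc) S nu := by
      rw [← (hG.down hlast).summable.tsum_mul_left, ← hG.summable.tsum_mul_left]
      exact tsum_congr fun nu => prod_mul_down_iterUp hW hS (hy _) (hC (hy _))
        (fun i => hy i.castSucc) nu
    rw [pairProduct, Fin.prod_univ_castSucc]
    calc _ = pairProduct n (fun i => y i.castSucc) *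
          ((∏ i : Fin n, (1 - y i.castSucc * y (Fin.last n))) *
            ((1 - y (Fin.last n)) * ∑' lam, iterUp W (n + 1) y S lam)) := by ring
      _ = C (y (Fin.last n)) * (pairProduct n (fun i => y i.castSucc) *
            ∑' nu, iterUp W n (fun i => y i.castSucc) S nu) := by
        rw [iterUp, mul_tsum_up hlast hG _ (hW.total (hy _)), hdown, mul_left_comm]
      _ = _ := by
        rw [pairProduct_mul_tsum_iterUp hW hS hC fun i => hy i.castSucc]
        ring

/-- The unit vector of the empty diagram. -/
noncomputable def emptyVec (lam : YoungDiagram) : MvPowerSeries σ ℤ :=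
  open Classical in if lam = ⊥ then 1 else 0

theorem isGraded_emptyVec : IsGraded (emptyVec (σ := σ)) := fun lam => by
  rw [emptyVec]
  split_ifs with h
  · subst h
    simp [YoungDiagram.card]
  · simp

theorem down_hStrip_emptyVec (t : MvPowerSeries σ ℤ) (nu : YoungDiagram) :
    down (hStrip t) emptyVec nu = 1 * emptyVec nu := by
  rw [down, tsum_eq_single ⊥ fun lam h => by simp [emptyVec, h]]
  by_cases h : nu = ⊥
  · subst h
    simp [emptyVec, hStrip, IsHorizontalStrip]
  · have : ¬ IsHorizontalStrip ⊥ nu := fun hs => h (le_bot_iff.1 hs.1)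
    simp [emptyVec, hStrip, this, h]

/-- The dual Cauchy identity, obtained from Cauchy's identity for `-t` by inverting the lowering
operator of horizontal strips. -/
theorem down_vStrip_iterUp_hStrip {m : ℕ} {x : Fin m → MvPowerSeries σ ℤ}
    (hx : ∀ i, (x i).constantCoeff = 0) {t : MvPowerSeries σ ℤ} (ht : t.constantCoeff = 0)
    (nu : YoungDiagram) :
    down (vStrip t) (iterUp hStrip m x emptyVec) nu =
      (∏ i, (1 + x i * t)) * iterUp hStrip m x emptyVec nu := by
  set H : YoungDiagram → MvPowerSeries σ ℤ := iterUp hStrip m x emptyVec with hH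
  have ht' : (-t).constantCoeff = 0 := by rw [map_neg, ht, neg_zero]
  have hG : IsGraded H := isGraded_emptyVec.iterUp isStripFamily_hStrip hx
  -- lowering with `-t` and then with `t` is the identity
  have hinv : down (vStrip t) (down (hStrip (-t)) H) nu = H nu := by
    have := tsum_mul_down (isGradedMatrix_hStrip ht') hG fun kap => vStrip t kap nu
    rw [down, this]
    simp only [tsum_hStrip_neg_mul_vStrip]
    rw [tsum_eq_single nu fun mu h => by rw [if_neg h, zero_mul], if_pos rfl, one_mul]
  have hdown : H = fun nu => (∏ i, (1 + x i * t)) * down (hStrip (-t)) H nu := by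
    funext nu
    have := prod_mul_down_iterUp isStripFamily_hStrip isGraded_emptyVec ht'
      (down_hStrip_emptyVec (-t)) hx nu
    simpa only [mul_neg, sub_neg_eq_add, one_mul] using this.symm
  conv_lhs => rw [hdown]
  rw [down_mul_left (hG.down (isGradedMatrix_hStrip ht')), hinv]

end Iterate

/-! ### Hook Schur functions as iterated raising -/

section HookSchur

variable {σ : Type*}

open Classical in
/-- The evaluated skew Schur polynomial, extended by `0` to the pairs with `mu ⊄ lam`. -/
noncomputable def skewSchurMatrix {k : ℕ} (x : Fin k → MvPowerSeries σ ℤ)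
    (lam mu : YoungDiagram) : MvPowerSeries σ ℤ :=
  if mu ≤ lam then skewSchurEval x lam mu else 0

theorem skewSchurMatrix_succ {k : ℕ} {x : Fin (k + 1) → MvPowerSeries σ ℤ}
    (hx : ∀ i, (x i).constantCoeff = 0) (lam mu : YoungDiagram) :
    skewSchurMatrix x lam mu = up (hStrip (x (Fin.last k)))
      (fun nu => skewSchurMatrix (fun i => x i.castSucc) nu mu) lam := by
  classical
  rw [up_eq_sum (isGradedMatrix_hStrip (hx _)), skewSchurMatrix]
  split_ifs with h
  · rw [skewSchurEval_succ x h, Finset.sum_filter]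
    refine Finset.sum_congr rfl fun nu _ => ?_
    rw [hStrip, skewSchurMatrix]
    split_ifs <;> simp_all
  · symm
    refine Finset.sum_eq_zero fun nu hnu => ?_
    have hle : nu ≤ lam := by simpa using hnu
    rw [skewSchurMatrix, if_neg fun h' => h (h'.trans hle), mul_zero]

theorem isGradedMatrix_skewSchurMatrix : ∀ {k : ℕ} {x : Fin k → MvPowerSeries σ ℤ}
    (_ : ∀ i, (x i).constantCoeff = 0), IsGradedMatrix (skewSchurMatrix x) := by
  intro k x hx
  refine ⟨fun h => ?_, ?_⟩
  · by_contra h'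
    exact h (if_neg h')
  · induction k with
    | zero =>
      intro lam mu
      rw [skewSchurMatrix]
      split_ifs with h
      · rw [skewSchurEval_zero x h]
        split_ifs with h'
        · subst h'
          exact le_add_self
        · simp
      · simp
    | succ k ih =>
      intro lam mu
      rw [skewSchurMatrix_succ hx]
      exact card_le_order_up (isGradedMatrix_hStrip (hx _)) _
        (fun nu => ih (fun i => hx i.castSucc) nu mu) lam

theorem skewSchurMatrix_bot : ∀ {k : ℕ} {x : Fin k → MvPowerSeries σ ℤ}
    (_ : ∀ i, (x i).constantCoeff = 0) (lam : YoungDiagram),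
    skewSchurMatrix x lam ⊥ = iterUp hStrip k x emptyVec lam
  | 0, x, _, lam => by
    rw [skewSchurMatrix, if_pos bot_le, skewSchurEval_zero x bot_le, iterUp, emptyVec]
  | k + 1, x, hx, lam => by
    rw [skewSchurMatrix_succ hx, iterUp]
    exact congrArg (fun S => up _ S lam)
      (funext fun nu => skewSchurMatrix_bot (fun i => hx i.castSucc) nu)

theorem tsum_skewSchurMatrix_transpose_mul {S : YoungDiagram → MvPowerSeries σ ℤ}
    (hS : IsGraded S) : ∀ {k : ℕ} {y : Fin k → MvPowerSeries σ ℤ}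
    (_ : ∀ i, (y i).constantCoeff = 0) (lam : YoungDiagram),
    ∑' mu, skewSchurMatrix y lam.transpose mu.transpose * S mu = iterUp vStrip k y S lam
  | 0, y, _, lam => by
    rw [tsum_eq_single lam, iterUp, skewSchurMatrix, if_pos le_rfl,
      skewSchurEval_zero y le_rfl, if_pos rfl, one_mul]
    intro mu hmu
    rw [skewSchurMatrix]
    split_ifs with h
    · rw [skewSchurEval_zero y h,
        if_neg fun h' => hmu (YoungDiagram.transpose_eq_iff.1 h').symm, zero_mul]
    · rw [zero_mul]
  | k + 1, y, hy, lam => by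
    have hM := isGradedMatrix_skewSchurMatrix fun i : Fin k => hy i.castSucc
    have hMt : IsGradedMatrix fun lam mu : YoungDiagram =>
        skewSchurMatrix (fun i => y i.castSucc) lam.transpose mu.transpose :=
      ⟨fun h => YoungDiagram.transpose_le_iff.1 (hM.le_of_ne_zero h), fun lam mu => by
        simpa only [card_transpose] using hM.card_le lam.transpose mu.transpose⟩
    have hup : ∀ mu : YoungDiagram, skewSchurMatrix y lam.transpose mu.transpose =
        ∑' kap, vStrip (y (Fin.last k)) lam kap *
          skewSchurMatrix (fun i => y i.castSucc) kap.transpose mu.transpose := fun mu => by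
      rw [skewSchurMatrix_succ hy, up, ← YoungDiagram.transposeOrderIso.toEquiv.tsum_eq]
      rfl
    rw [iterUp, up, tsum_congr fun mu => congrArg (· * S mu) (hup mu),
      ← tsum_mul_up hMt hS]
    refine tsum_congr fun kap => congrArg _ ?_
    exact tsum_skewSchurMatrix_transpose_mul hS (fun i => hy i.castSucc) kap

/-- The family of hook Schur functions is raised from the unit vector of the empty diagram, along
horizontal strips for the even and along vertical strips for the odd variables. -/
theorem coe_hookSchur (m n : ℕ) (lam : YoungDiagram) :
    (hookSchur m n lam : MvPowerSeries (Fin (m + n)) ℤ) =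
      iterUp vStrip n (fun j => MvPowerSeries.X (Fin.natAdd m j))
        (iterUp hStrip m (fun i => MvPowerSeries.X (Fin.castAdd n i)) emptyVec) lam := by
  have hx : ∀ i : Fin m, (MvPowerSeries.X (Fin.castAdd n i) :
      MvPowerSeries (Fin (m + n)) ℤ).constantCoeff = 0 := fun i => MvPowerSeries.constantCoeff_X _
  have hy : ∀ j : Fin n, (MvPowerSeries.X (Fin.natAdd m j) :
      MvPowerSeries (Fin (m + n)) ℤ).constantCoeff = 0 := fun j => MvPowerSeries.constantCoeff_X _
  -- renaming variables and passing to power series is evaluation at the new variables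
  have hcoe : ∀ {k : ℕ} (f : Fin k → Fin (m + n)) (p : MvPolynomial (Fin k) ℤ),
      ((MvPolynomial.rename f p : MvPolynomial (Fin (m + n)) ℤ) :
        MvPowerSeries (Fin (m + n)) ℤ) = MvPolynomial.aeval (fun i => MvPowerSeries.X (f i)) p := by
    intro k f p
    have : (MvPolynomial.coeToMvPowerSeries.algHom ℤ).comp (MvPolynomial.rename f) =
        MvPolynomial.aeval (R := ℤ) fun i => (MvPowerSeries.X (f i) :
          MvPowerSeries (Fin (m + n)) ℤ) := by
      ext i
      simp
    have h := DFunLike.congr_fun this p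
    simpa using h
  rw [← tsum_skewSchurMatrix_transpose_mul
    (isGraded_emptyVec.iterUp isStripFamily_hStrip hx) hy,
    tsum_eq_sum (s := (finite_subdiagrams lam).toFinset), hookSchur,
    ← MvPolynomial.coeToMvPowerSeries.ringHom_apply, map_sum]
  · refine Finset.sum_congr rfl fun mu hmu => ?_
    have hle : mu ≤ lam := by simpa using hmu
    rw [map_mul, MvPolynomial.coeToMvPowerSeries.ringHom_apply,
      MvPolynomial.coeToMvPowerSeries.ringHom_apply, hcoe, hcoe, schur, aeval_skewSchur,
      aeval_skewSchur, ← skewSchurMatrix_bot hx, skewSchurMatrix, skewSchurMatrix, if_pos bot_le,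
      if_pos (YoungDiagram.transpose_le_iff.2 hle), mul_comm]
  · intro mu hmu
    rw [skewSchurMatrix, if_neg, zero_mul]
    exact fun h => hmu (by simpa using h)

end HookSchur

/-! ### The products -/

theorem prod_filter_pairs {A ι : Type*} [CommMonoid A] [Fintype ι] (f : ι × ι → A)
    (P : ι → ι → Prop) [∀ i j, Decidable (P i j)] :
    ∏ p : ι × ι with P p.1 p.2, f p = ∏ i, ∏ j, if P i j then f (i, j) else 1 := by
  rw [Finset.prod_filter, Fintype.prod_prod_type]

theorem pairProduct_eq {σ : Type*} : ∀ (n : ℕ) (y : Fin n → MvPowerSeries σ ℤ),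
    pairProduct n y = (∏ i, (1 - y i)) * ∏ i, ∏ j, if i < j then 1 - y i * y j else 1
  | 0, _ => by simp [pairProduct]
  | n + 1, y => by
    have h : ∀ i : Fin n, ¬ Fin.last n < i.castSucc := fun i => (Fin.castSucc_lt_last i).not_gt
    simp only [pairProduct, pairProduct_eq n, Fin.prod_univ_castSucc, Fin.castSucc_lt_castSucc_iff,
      Fin.castSucc_lt_last, h, if_true, if_false, lt_irrefl, Finset.prod_const_one, mul_one,
      Finset.prod_mul_distrib]
    ring

theorem parity_castAdd (m n : ℕ) (i : Fin m) : parity m n (Fin.castAdd n i) = 0 := by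
  simp [parity]

theorem parity_natAdd (m n : ℕ) (j : Fin n) : parity m n (Fin.natAdd m j) = 1 := by
  simp [parity]

theorem castAdd_lt_natAdd (m n : ℕ) (i : Fin m) (j : Fin n) :
    Fin.castAdd n i < Fin.natAdd m j := by
  rw [Fin.lt_def, Fin.val_castAdd, Fin.val_natAdd]
  omega

theorem numerator_eq (m n : ℕ) :
    numerator m n = ∏ j : Fin n, ∏ i : Fin m,
      (1 + MvPowerSeries.X (Fin.castAdd n i) * MvPowerSeries.X (Fin.natAdd m j)) := by
  have h : ∀ (i : Fin m) (j : Fin n), ¬ Fin.natAdd m j < Fin.castAdd n i := fun i j =>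
    (castAdd_lt_natAdd m n i j).not_gt
  rw [numerator, prod_filter_pairs _ fun i j => i < j ∧ parity m n i ≠ parity m n j,
    Finset.prod_comm (γ := Fin n)]
  simp [Fin.prod_univ_add, parity_castAdd, parity_natAdd, castAdd_lt_natAdd, h]

theorem denominator_eq (m n : ℕ) :
    denominator m n = pairProduct m (fun i => MvPowerSeries.X (Fin.castAdd n i)) *
      pairProduct n (fun j => MvPowerSeries.X (Fin.natAdd m j)) := by
  rw [denominator, prod_filter_pairs _ fun i j => i < j ∧ parity m n i = parity m n j,
    pairProduct_eq, pairProduct_eq]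
  have h : ∀ i i' : Fin m, Fin.castAdd n i < Fin.castAdd n i' ↔ i < i' := fun i i' => Iff.rfl
  simp [Fin.prod_univ_add, parity_castAdd, parity_natAdd, h]
  ring

end HookSchur

theorem mainTheorem3 (m n : ℕ) :
    IsUnit (HookSchur.denominator m n) ∧
      HasSum
        (fun lam : YoungDiagram =>
          (HookSchur.hookSchur m n lam : MvPowerSeries (Fin (m + n)) ℤ))
        (HookSchur.numerator m n * Ring.inverse (HookSchur.denominator m n)) := by
  open HookSchur in
  have hx : ∀ i : Fin m, (MvPowerSeries.X (Fin.castAdd n i) :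
      MvPowerSeries (Fin (m + n)) ℤ).constantCoeff = 0 := fun i => MvPowerSeries.constantCoeff_X _
  have hy : ∀ j : Fin n, (MvPowerSeries.X (Fin.natAdd m j) :
      MvPowerSeries (Fin (m + n)) ℤ).constantCoeff = 0 := fun j => MvPowerSeries.constantCoeff_X _
  have hunit : IsUnit (denominator m n) := by
    rw [MvPowerSeries.isUnit_iff_constantCoeff, denominator]
    simp
  have hG := isGraded_emptyVec.iterUp isStripFamily_hStrip hx
  have heven := pairProduct_mul_tsum_iterUp isStripFamily_hStrip isGraded_emptyVec
    (C := fun _ => 1) (fun _ => down_hStrip_emptyVec _) hx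
  have hodd := pairProduct_mul_tsum_iterUp isStripFamily_vStrip hG
    (C := fun t => ∏ i : Fin m, (1 + MvPowerSeries.X (Fin.castAdd n i) * t))
    (fun ht => down_vStrip_iterUp_hStrip hx ht) hy
  have hempty : ∑' lam, emptyVec lam = (1 : MvPowerSeries (Fin (m + n)) ℤ) := by
    rw [tsum_eq_single ⊥ fun lam h => (show emptyVec lam = 0 from if_neg h), emptyVec, if_pos rfl]
  rw [hempty, mul_one, Finset.prod_const_one] at heven
  rw [← numerator_eq] at hodd
  refine ⟨hunit, ?_⟩
  have hsum := (hG.iterUp isStripFamily_vStrip hy).summable.hasSum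
  simp only [coe_hookSchur]
  convert hsum using 1
  symm
  rw [Ring.eq_mul_inverse_iff_mul_eq _ _ _ hunit, denominator_eq, mul_comm, mul_assoc, hodd,
    mul_left_comm, heven, mul_one]
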